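/- **Setting.** Let $p\ge 1$, and let $H_o=N(\mathbf 0,\mathbf I_{p+1})$ be the joint distribution of $(y,\mathbf x)\in\mathbb R\times\mathbb R^p$ (the Gaussian model, with true intercept and slopes equal to zero). Let $\rho:\mathbb R\to\mathbb R$ satisfy * **A3.** $\rho$ is symmetric, nondecreasing on $[0,\infty)$, $\rho(0)=0$; $\rho$ is bounded with $\lim_{u\to\infty}\rho(u)=1$; $\rho$ has only finitely many discontinuities. * **A4.** With $Z$ standard normal, $g(s)=E\rho(Z/s)$ is continuously differentiable on $(0,\infty)$, and $\phi(s)=-s\,g'(s)$ is unimodal on $(0,\infty)$ with its maximum attained at some $\sigma_M>0$ ($\phi$ is nondecreasing on $(0,\sigma_M]$ and nonincreasing on $[\sigma_M,\infty)$). Put $K=\phi(\sigma_M)$. Fix $0<b<1$ and $c>0$. For a probability distribution $H$ on $\mathbb R^{p+1}$, the S-estimate based on $\rho$ and $b$ minimizes $s>0$, and the CM-estimate based on $\rho$, $b$, $c$ minimizes $c\,E_H\rho\big((y-\alpha-\mathbf x'\boldsymbol\theta)/s\big)+\log s$, over $\alpha\in\mathbb R$, $\boldsymbol\theta\in\mathbb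 R^p$, $s>0$, in both cases subject to $E_H\rho\big((y-\alpha-\mathbf x'\boldsymbol\theta)/s\big)\le b$. That is, $(\alpha,\boldsymbol\theta)$ is a minimizer of the infimum of the objective over the feasible $s>0$ (the infimum over $s$ need not be attained; the infimum over the empty set is $+\infty$, and a minimizer is required to have a value other than $+\infty$). Let $\mathbf T_S(H)$ and $\mathbf T_{CM}(H)$ be the slopes $\boldsymbol\theta$ of any choice of such a minimizer; they are undefined only where there is none. For $\mathbf T\in\{\mathbf T_S,\mathbf T_{CM}\}$ and $0\le\varepsilon\le1$ the maximum bias is $$B_{\mathbf T}(\varepsilon)=\sup\big\{\|\mathbf T(H)\| : H=(1-\varepsilon)H_o+\varepsilon H^*,\ H^*\text{ a probability distribution on }\mathbb R^{p+1}\big\}\in[0,\infty],$$ where $\|\mathbf T(H)\|:=\infty$ if $\mathbf T(H)$ is undefined. Write $B_S$ and $B_{CM}$ for the maximum biases of $\mathbf T_S$ and $\mathbf T_{CM}$. **Theorem 6.1.** (i) If $c\le 1/K$, then $B_{CM}(\varepsilon)=B_S(\varepsilon)$ for all $\varepsilon\in[0,1]$. (ii) Let $0<\varepsilon<1$ be such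 that $\sigma_{b,\varepsilon}=g^{-1}\big[(b-\varepsilon)/(1-\varepsilon)\big]$ and $\gamma_{b,\varepsilon}=g^{-1}\big[b/(1-\varepsilon)\big]$ exist in $(0,\infty)$. If $c>c(\varepsilon)=\varepsilon^{-1}\log(\sigma_{b,\varepsilon}/\gamma_{b,\varepsilon})$, then $B_{CM}(\varepsilon)>B_S(\varepsilon)$. -/

import Mathlib

open MeasureTheory ProbabilityTheory Set

noncomputable section

namespace MaxBias

/-- The space of observations `(y, x)`: a real response `y` and a vector `x` of `p` regressors. -/
abbrev Obs (p : ℕ) : Type := ℝ × EuclideanSpace ℝ (Fin p)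

/-- The Gaussian model `N(0, I_{p+1})`: `y` and `x` are independent and standard normal. -/
def gaussianModel (p : ℕ) : Measure (Obs p) :=
  (gaussianReal 0 1).prod (stdGaussian (EuclideanSpace ℝ (Fin p)))

/-- The contaminated distribution `(1 - ε) H₀ + ε H*` around the Gaussian model. -/
def contaminated (p : ℕ) (ε : ℝ) (Hstar : Measure (Obs p)) : Measure (Obs p) :=
  ENNReal.ofReal (1 - ε) • gaussianModel p + ENNReal.ofReal ε • Hstar

/-- The conditions on a loss function: symmetric, nondecreasing on `[0, ∞)`, zero at zero,
bounded with limit one at infinity, and with finitely many discontinuities. -/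
structure IsLoss (ρ : ℝ → ℝ) : Prop where
  even : ∀ u, ρ (-u) = ρ u
  mono : MonotoneOn ρ (Ici 0)
  zero : ρ 0 = 0
  bounded : ∃ C, ∀ u, |ρ u| ≤ C
  tendsto_one : Filter.Tendsto ρ Filter.atTop (nhds 1)
  finite_discontinuities : {u | ¬ ContinuousAt ρ u}.Finite

/-- `g(s) = E ρ(Z / s)` for a standard normal `Z` (used for `s > 0`). -/
def g (ρ : ℝ → ℝ) (s : ℝ) : ℝ := ∫ z, ρ (z / s) ∂(gaussianReal 0 1)

/-- `φ(s) = - s g'(s)` (used for `s > 0`). -/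
def phi (ρ : ℝ → ℝ) (s : ℝ) : ℝ := -s * deriv (g ρ) s

/-- `g` is continuously differentiable on `(0, ∞)`, and `φ` is unimodal on `(0, ∞)` with its
maximum attained at `σM`. -/
structure IsSmoothUnimodal (ρ : ℝ → ℝ) (σM : ℝ) : Prop where
  contDiffOn : ContDiffOn ℝ 1 (g ρ) (Ioi 0)
  pos : 0 < σM
  monotoneOn : MonotoneOn (phi ρ) (Ioc 0 σM)
  antitoneOn : AntitoneOn (phi ρ) (Ici σM)

variable {p : ℕ}

/-- `E_H ρ((y - α - x'θ) / s)`. -/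
def meanLoss (ρ : ℝ → ℝ) (H : Measure (Obs p)) (α : ℝ) (θ : EuclideanSpace ℝ (Fin p))
    (s : ℝ) : ℝ :=
  ∫ z, ρ ((z.1 - α - inner ℝ z.2 θ) / s) ∂H

/-- The scales `s > 0` that satisfy the constraint `E_H ρ((y - α - x'θ) / s) ≤ b`. -/
def feasibleScales (ρ : ℝ → ℝ) (b : ℝ) (H : Measure (Obs p)) (α : ℝ)
    (θ : EuclideanSpace ℝ (Fin p)) : Set ℝ :=
  {s | 0 < s ∧ meanLoss ρ H α θ s ≤ b}

/-- The objective of the S-estimate as a function of intercept and slopes: the scale `s` minimized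
subject to the constraint. It is `⊤` if no scale is feasible. -/
def objS (ρ : ℝ → ℝ) (b : ℝ) (H : Measure (Obs p)) (α : ℝ)
    (θ : EuclideanSpace ℝ (Fin p)) : EReal :=
  ⨅ s ∈ feasibleScales ρ b H α θ, (s : EReal)

/-- The objective of the CM-estimate as a function of intercept and slopes: the function
`c E_H ρ((y - α - x'θ) / s) + log s`, minimized over `s` subject to the same constraint. -/
def objCM (ρ : ℝ → ℝ) (b c : ℝ) (H : Measure (Obs p)) (α : ℝ)
    (θ : EuclideanSpace ℝ (Fin p)) : EReal :=
  ⨅ s ∈ feasibleScales ρ b H α θ, ((c * meanLoss ρ H α θ s + Real.log s : ℝ) : EReal)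

/-- The slope parts of the minimizers `(α, θ)` of an objective. A minimizer has to be feasible,
that is, to have an objective other than `⊤`. -/
def slopeMinimizers (J : ℝ → EuclideanSpace ℝ (Fin p) → EReal) :
    Set (EuclideanSpace ℝ (Fin p)) :=
  {θ | ∃ α, J α θ < ⊤ ∧ ∀ α' θ', J α θ ≤ J α' θ'}

/-- `T` is a slope functional that solves the minimization problem `J`: at each probability
distribution `H` it picks the slopes of some minimizer of `J H`, and it is undefined (`none`) only
where there is no minimizer. -/
def IsSlopeFunctional
    (J : Measure (Obs p) → ℝ → EuclideanSpace ℝ (Fin p) → EReal)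
    (T : Measure (Obs p) → Option (EuclideanSpace ℝ (Fin p))) : Prop :=
  ∀ H, IsProbabilityMeasure H →
    (∀ θ, T H = some θ → θ ∈ slopeMinimizers (J H)) ∧
      (T H = none → slopeMinimizers (J H) = ∅)

/-- `T` is the slope part of an S-estimate based on `ρ` and `b`. -/
def IsSEstimate (ρ : ℝ → ℝ) (b : ℝ)
    (T : Measure (Obs p) → Option (EuclideanSpace ℝ (Fin p))) : Prop :=
  IsSlopeFunctional (objS ρ b) T

/-- `T` is the slope part of a CM-estimate based on `ρ`, `b` and the tuning constant `c`. -/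
def IsCMEstimate (ρ : ℝ → ℝ) (b c : ℝ)
    (T : Measure (Obs p) → Option (EuclideanSpace ℝ (Fin p))) : Prop :=
  IsSlopeFunctional (objCM ρ b c) T

/-- The asymptotic bias at `H`: the Euclidean norm of `T(H)`, and `∞` where `T` is undefined. The
true parameters are zero and the scatter matrix of the regressors is the identity. -/
def bias (T : Measure (Obs p) → Option (EuclideanSpace ℝ (Fin p))) (H : Measure (Obs p)) :
    ENNReal :=
  match T H with
  | some θ => ‖θ‖ₑ
  | none => ⊤

/-- The maximum bias function: the supremum of the bias over the `ε`-contamination neighborhood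
of the Gaussian model. -/
def maxBias (T : Measure (Obs p) → Option (EuclideanSpace ℝ (Fin p))) (ε : ℝ) : ENNReal :=
  ⨆ (Hstar : Measure (Obs p)) (_ : IsProbabilityMeasure Hstar), bias T (contaminated p ε Hstar)

end MaxBias

end

/-! Write `h s = c (1-ε) g(s) + log s` and `τ = √(1+‖θ‖²)`. The S-estimate is the CM-estimate with
`c = 0` (`slopeMinimizers_objS`), so every bound is proved for `c ≥ 0` and applied twice.

Under the model the residual is normal with standard deviation `τ`, and centering it minimizes the
mean loss. Hence the Gaussian part of the mean loss at `θ` is at least `(1-ε) g(s/τ)`, with equality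
at intercept 0, and the objective at scale `s` is at least `h(s/τ) + log τ`. Feasibility forces `s/τ
≥ γ`, while slope 0 with scale `σ` is always feasible, with value at most `c b + log σ`. If `h` is
minimal at `γ` on `[γ, ∞)`, a minimizer has `τ ≤ σ/γ` (`maxBias_le`); that a minimizer exists is
`slopeMinimizers_nonempty`.

Conversely, contaminate with an exact fit at slopes `θ₀` with widely spread regressors. It costs
nothing at `θ₀` and almost the full `ε` at slopes away from it. So bias above `R` is forced once
`h(s₁) + log √(1+R²) < c ε + inf h` over `[σ, ∞)`, for some `s₁` with `(1-ε) g(s₁) ≤ b`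
(`lt_maxBias`).

(i) If `c K ≤ 1`, `h` is monotone and the two bounds meet at `√((σ/γ)²-1)`, in which `c` no longer
appears. If `σ` or `γ` fails to exist, or `1-ε ≤ b`, both maximum biases are infinite. (ii) A
near-minimizer `s₁` of `h` on `[σ, ∞)` makes the lower-bound condition read `log(σ/γ) < c ε`, up to
a small error, at `R = √((σ/γ)²-1)`, which bounds the bias of the S-estimate. -/

open Filter Topology

namespace MaxBias

/-! ### Normal distributions: translates and linear images -/

section Gaussian

/-- Among the translates of a standard normal variable, the centered one has the smallest
expectation of a bounded even function that increases away from the origin. -/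
theorem integral_gaussianReal_le_integral_sub {f : ℝ → ℝ} (hf : Measurable f)
    {C : ℝ} (hC : ∀ u, |f u| ≤ C) (hmono : ∀ u v, |u| ≤ |v| → f u ≤ f v) (a : ℝ) :
    ∫ z, f z ∂(gaussianReal 0 1) ≤ ∫ z, f (z - a) ∂(gaussianReal 0 1) := by
  have heven : ∀ u, f (-u) = f u := fun u =>
    le_antisymm (hmono _ _ (by simp)) (hmono _ _ (by simp))
  set q : ℝ → ℝ := gaussianPDFReal 0 1 with hq
  have hqi : Integrable q := integrable_gaussianPDFReal 0 1
  have hqeven : ∀ z, q (-z) = q z := fun z => by simp [hq, gaussianPDFReal]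
  have hqanti : ∀ u v, |u| ≤ |v| → q v ≤ q u := by
    intro u v huv
    have := sq_le_sq.2 huv
    simp only [hq, gaussianPDFReal, sub_zero, NNReal.coe_one]
    gcongr
  have key : ∀ x y : ℝ, Integrable fun z => q (z + x) * f (z + y) := fun x y =>
    (hqi.comp_add_right x).mul_bdd (c := C)
      (hf.comp (measurable_id.add_const y)).aestronglyMeasurable
      (Filter.Eventually.of_forall fun z => hC _)
  have k00 : Integrable fun z => q z * f z := by simpa using key 0 0
  have k0a : Integrable fun z => q z * f (z + a) := by simpa using key 0 a
  have ka0 : Integrable fun z => q (z + a) * f z := by simpa using key a 0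
  rw [integral_gaussianReal_eq_integral_smul one_ne_zero,
    integral_gaussianReal_eq_integral_smul one_ne_zero]
  simp only [smul_eq_mul, ← hq]
  have e1 : ∫ z, q z * f (z - a) = ∫ z, q (z + a) * f z := by
    rw [← integral_add_right_eq_self (fun z => q z * f (z - a)) a]
    simp
  have e2 : ∫ z, q z * f (z - a) = ∫ z, q z * f (z + a) := by
    rw [← integral_neg_eq_self]
    refine integral_congr_ae (Filter.Eventually.of_forall fun z => ?_)
    simp only [hqeven]
    rw [← heven (z + a)]
    ring_nf
  have e3 : ∫ z, q z * f z = ∫ z, q (z + a) * f (z + a) :=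
    (integral_add_right_eq_self (fun z => q z * f z) a).symm
  -- Rearrangement: the integrand factors as `(q(z+a) - q z)(f z - f(z+a))`, whose factors have the
  -- same sign because `q` decreases and `f` increases in the absolute value. Its integral is twice
  -- the claimed difference.
  have hpos : 0 ≤ ∫ z, ((q (z + a) * f z + q z * f (z + a)) -
      (q z * f z + q (z + a) * f (z + a))) := by
    refine integral_nonneg fun z => ?_
    have : (q (z + a) * f z + q z * f (z + a)) - (q z * f z + q (z + a) * f (z + a)) =
      (q (z + a) - q z) * (f z - f (z + a)) := by ring
    simp only [Pi.zero_apply, this]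
    rcases le_total |z| |z + a| with h | h
    · exact mul_nonneg_of_nonpos_of_nonpos (sub_nonpos.2 (hqanti _ _ h))
        (sub_nonpos.2 (hmono _ _ h))
    · exact mul_nonneg (sub_nonneg.2 (hqanti _ _ h)) (sub_nonneg.2 (hmono _ _ h))
  have hs : ∫ z, ((q (z + a) * f z + q z * f (z + a)) -
      (q z * f z + q (z + a) * f (z + a))) =
      (∫ z, (q (z + a) * f z + q z * f (z + a))) - ∫ z, (q z * f z + q (z + a) * f (z + a)) :=
    integral_sub (ka0.add k0a) (k00.add (key a a))
  rw [hs, integral_add ka0 k0a, integral_add k00 (key a a), ← e1, ← e2, ← e3] at hpos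
  linarith

theorem stdGaussian_map_inner {E : Type*} [NormedAddCommGroup E] [InnerProductSpace ℝ E]
    [FiniteDimensional ℝ E] [MeasurableSpace E] [BorelSpace E] (θ : E) :
    (stdGaussian E).map (fun x => inner ℝ x θ) = gaussianReal 0 (‖θ‖ ^ 2).toNNReal := by
  have h := IsGaussian.map_eq_gaussianReal (μ := stdGaussian E) (innerSL ℝ θ)
  rw [variance_dual_stdGaussian, integral_strongDual_stdGaussian, innerSL_apply_norm] at h
  rw [← h]
  congr 1
  ext x
  simp [real_inner_comm]

theorem gaussianReal_map_mul (t : ℝ) :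
    (gaussianReal 0 1).map (fun z => t * z) = gaussianReal 0 (t ^ 2).toNNReal := by
  rw [gaussianReal_map_const_mul, mul_zero, mul_one]
  congr 1
  ext
  simp [sq_nonneg]

theorem integral_stdGaussian_inner {E : Type*} [NormedAddCommGroup E] [InnerProductSpace ℝ E]
    [FiniteDimensional ℝ E] [MeasurableSpace E] [BorelSpace E] (θ : E) {f : ℝ → ℝ}
    (hf : Measurable f) :
    ∫ x, f (inner ℝ x θ) ∂(stdGaussian E) = ∫ z, f (‖θ‖ * z) ∂(gaussianReal 0 1) := by
  rw [← integral_map (φ := fun x : E => inner ℝ x θ) (by fun_prop) hf.aestronglyMeasurable,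
    ← integral_map (φ := fun z : ℝ => ‖θ‖ * z) (by fun_prop) hf.aestronglyMeasurable,
    stdGaussian_map_inner, gaussianReal_map_mul]

theorem gaussianModel_map_residual (p : ℕ) (θ : EuclideanSpace ℝ (Fin p)) :
    (gaussianModel p).map (fun z => z.1 - inner ℝ z.2 θ) =
      gaussianReal 0 (1 + ‖θ‖ ^ 2).toNNReal := by
  have hind : IndepFun (fun z : Obs p => z.1) (fun z : Obs p => inner ℝ z.2 (-θ))
      (gaussianModel p) :=
    indepFun_prod (X := fun y : ℝ => y)
      (Y := fun x : EuclideanSpace ℝ (Fin p) => (inner ℝ x (-θ) : ℝ)) (by fun_prop) (by fun_prop)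
  have h1 : (gaussianModel p).map (fun z => z.1) = gaussianReal 0 1 := by
    have := Measure.map_fst_prod (μ := gaussianReal 0 1)
      (ν := stdGaussian (EuclideanSpace ℝ (Fin p)))
    rw [measure_univ, one_smul] at this
    exact this
  have h2 : (gaussianModel p).map (fun z => inner ℝ z.2 (-θ)) =
      gaussianReal 0 (‖θ‖ ^ 2).toNNReal := by
    have := Measure.map_snd_prod (μ := gaussianReal 0 1)
      (ν := stdGaussian (EuclideanSpace ℝ (Fin p)))
    rw [← norm_neg θ, ← stdGaussian_map_inner,
      show (fun z : Obs p => (inner ℝ z.2 (-θ) : ℝ)) =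
        (fun x => inner ℝ x (-θ)) ∘ Prod.snd from rfl,
      ← Measure.map_map (by fun_prop) measurable_snd]
    rw [gaussianModel, this, measure_univ, one_smul]
  have h := gaussianReal_add_gaussianReal_of_indepFun hind h1 h2
  have e : (fun z : Obs p => z.1 - (inner ℝ z.2 θ : ℝ)) =
      (fun z : Obs p => z.1) + fun z : Obs p => (inner ℝ z.2 (-θ) : ℝ) := by
    ext z
    simp [sub_eq_add_neg]
  rw [e, h, add_zero, Real.toNNReal_add zero_le_one (sq_nonneg _), Real.toNNReal_one]

theorem integral_gaussianModel_residual (p : ℕ) (θ : EuclideanSpace ℝ (Fin p)) {f : ℝ → ℝ}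
    (hf : Measurable f) :
    ∫ z, f (z.1 - inner ℝ z.2 θ) ∂(gaussianModel p) =
      ∫ z, f (√(1 + ‖θ‖ ^ 2) * z) ∂(gaussianReal 0 1) := by
  rw [← integral_map (φ := fun z : Obs p => z.1 - inner ℝ z.2 θ) (by fun_prop)
      hf.aestronglyMeasurable,
    ← integral_map (φ := fun z : ℝ => √(1 + ‖θ‖ ^ 2) * z) (by fun_prop) hf.aestronglyMeasurable,
    gaussianModel_map_residual, gaussianReal_map_mul, Real.sq_sqrt (by positivity)]

end Gaussian

end MaxBias

/-! ### Loss functions and the function `g` -/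

namespace MaxBias

namespace IsLoss

variable {ρ : ℝ → ℝ}

theorem apply_abs (hρ : IsLoss ρ) (u : ℝ) : ρ |u| = ρ u := by
  rcases abs_choice u with h | h <;> rw [h]
  exact hρ.even u

theorem le_of_abs_le (hρ : IsLoss ρ) {u v : ℝ} (h : |u| ≤ |v|) : ρ u ≤ ρ v := by
  rw [← hρ.apply_abs u, ← hρ.apply_abs v]
  exact hρ.mono (abs_nonneg u) (abs_nonneg v) h

theorem nonneg (hρ : IsLoss ρ) (u : ℝ) : 0 ≤ ρ u := by
  rw [← hρ.zero]
  exact hρ.le_of_abs_le (by simp)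

theorem le_one (hρ : IsLoss ρ) (u : ℝ) : ρ u ≤ 1 := by
  refine ge_of_tendsto hρ.tendsto_one ?_
  filter_upwards [eventually_ge_atTop |u|] with v hv
  exact hρ.le_of_abs_le (hv.trans (le_abs_self v))

theorem abs_le_one (hρ : IsLoss ρ) (u : ℝ) : |ρ u| ≤ 1 :=
  abs_le.2 ⟨by linarith [hρ.nonneg u], hρ.le_one u⟩

theorem measurable (hρ : IsLoss ρ) : Measurable ρ := by
  have hm : Monotone fun u => ρ (max u 0) := fun u v huv =>
    hρ.mono (mem_Ici.2 (le_max_right _ _)) (mem_Ici.2 (le_max_right _ _)) (max_le_max_right 0 huv)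
  have : ρ = (fun u => ρ (max u 0)) ∘ fun u => |u| := by
    ext u
    simp [hρ.apply_abs]
  rw [this]
  exact hm.measurable.comp measurable_abs

theorem integrable (hρ : IsLoss ρ) {Ω : Type*} [MeasurableSpace Ω] (μ : Measure Ω)
    [IsFiniteMeasure μ] {r : Ω → ℝ} (hr : Measurable r) : Integrable (fun ω => ρ (r ω)) μ :=
  Integrable.of_bound (hρ.measurable.comp hr).aestronglyMeasurable 1
    (Eventually.of_forall fun _ => hρ.abs_le_one _)

theorem integral_nonneg (hρ : IsLoss ρ) {Ω : Type*} [MeasurableSpace Ω] (μ : Measure Ω)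
    (r : Ω → ℝ) : 0 ≤ ∫ ω, ρ (r ω) ∂μ :=
  MeasureTheory.integral_nonneg fun _ => hρ.nonneg _

theorem integral_le_one (hρ : IsLoss ρ) {Ω : Type*} [MeasurableSpace Ω] (μ : Measure Ω)
    [IsProbabilityMeasure μ] {r : Ω → ℝ} (hr : Measurable r) : ∫ ω, ρ (r ω) ∂μ ≤ 1 := by
  have := integral_mono (hρ.integrable μ hr) (integrable_const (1 : ℝ)) fun ω => hρ.le_one _
  simpa using this

theorem integral_mono_abs (hρ : IsLoss ρ) {Ω : Type*} [MeasurableSpace Ω] (μ : Measure Ω)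
    [IsFiniteMeasure μ] {r t : Ω → ℝ} (hr : Measurable r) (ht : Measurable t)
    (h : ∀ ω, |r ω| ≤ |t ω|) : ∫ ω, ρ (r ω) ∂μ ≤ ∫ ω, ρ (t ω) ∂μ :=
  integral_mono (hρ.integrable μ hr) (hρ.integrable μ ht) fun ω => hρ.le_of_abs_le (h ω)

theorem tendsto_integral_one (hρ : IsLoss ρ) {Ω : Type*} [MeasurableSpace Ω] (μ : Measure Ω)
    [IsProbabilityMeasure μ] {ι : Type*} {l : Filter ι} [l.IsCountablyGenerated]
    {r : ι → Ω → ℝ} (hr : ∀ i, Measurable (r i))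
    (h : ∀ᵐ ω ∂μ, Tendsto (fun i => |r i ω|) l atTop) :
    Tendsto (fun i => ∫ ω, ρ (r i ω) ∂μ) l (𝓝 1) := by
  have : Tendsto (fun i => ∫ ω, ρ (r i ω) ∂μ) l (𝓝 (∫ _, (1 : ℝ) ∂μ)) := by
    refine tendsto_integral_filter_of_dominated_convergence (fun _ => 1)
      (Eventually.of_forall fun i => (hρ.measurable.comp (hr i)).aestronglyMeasurable)
      (Eventually.of_forall fun i => Eventually.of_forall fun ω => hρ.abs_le_one _)
      (integrable_const _) ?_
    filter_upwards [h] with ω hω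
    simpa [Function.comp_def, hρ.apply_abs] using hρ.tendsto_one.comp hω
  simpa using this

theorem g_nonneg (hρ : IsLoss ρ) (s : ℝ) : 0 ≤ g ρ s := hρ.integral_nonneg _ _

theorem g_le_one (hρ : IsLoss ρ) (s : ℝ) : g ρ s ≤ 1 := hρ.integral_le_one _ (by fun_prop)

theorem g_antitoneOn (hρ : IsLoss ρ) : AntitoneOn (g ρ) (Ioi 0) := by
  intro s hs t ht hst
  rw [mem_Ioi] at hs ht
  refine hρ.integral_mono_abs _ (by fun_prop) (by fun_prop) fun z => ?_
  rw [abs_div, abs_div, abs_of_pos hs, abs_of_pos ht]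
  exact div_le_div_of_nonneg_left (abs_nonneg z) hs hst

theorem ae_ne_zero : ∀ᵐ z ∂(gaussianReal 0 1), z ≠ (0 : ℝ) := by
  have := nullSingletonClass_gaussianReal (μ := 0) (v := 1) one_ne_zero
  exact Measure.ae_ne _ _

theorem tendsto_g_zero (hρ : IsLoss ρ) : Tendsto (g ρ) (𝓝[>] 0) (𝓝 1) := by
  refine hρ.tendsto_integral_one _ (fun s => by fun_prop) ?_
  filter_upwards [ae_ne_zero] with z hz
  have : Tendsto (fun s : ℝ => |z| * s⁻¹) (𝓝[>] 0) atTop :=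
    Tendsto.const_mul_atTop (abs_pos.2 hz) tendsto_inv_nhdsGT_zero
  refine this.congr' ?_
  filter_upwards [self_mem_nhdsWithin] with s hs
  rw [mem_Ioi] at hs
  rw [abs_div, abs_of_pos hs, div_eq_mul_inv]

/-- Below its maximal value `1`, the function `g` is strictly decreasing. -/
theorem g_lt_g (hρ : IsLoss ρ) {s t : ℝ} (hs : 0 < s) (hst : s < t) (h1 : g ρ t < 1) :
    g ρ t < g ρ s := by
  have ht : 0 < t := hs.trans hst
  refine lt_of_le_of_ne (hρ.g_antitoneOn hs ht hst.le) fun heq => h1.ne ?_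
  have hle : ∀ z : ℝ, ρ (z / t) ≤ ρ (z / s) := fun z => hρ.le_of_abs_le (by
    rw [abs_div, abs_div, abs_of_pos hs, abs_of_pos ht]
    exact div_le_div_of_nonneg_left (abs_nonneg z) hs hst.le)
  have hae : ∀ᵐ z ∂(gaussianReal 0 1), ρ (z / t) = ρ (z / s) :=
    (integral_eq_iff_of_ae_le (hρ.integrable _ (by fun_prop)) (hρ.integrable _ (by fun_prop))
      (Eventually.of_forall hle)).1 heq
  have hvol : ∀ᵐ z : ℝ, ρ (z / t) = ρ (z / s) :=
    (gaussianReal_absolutelyContinuous' 0 one_ne_zero).ae_le hae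
  set q := t / s with hq
  have hq1 : 1 < q := (one_lt_div hs).2 hst
  have hq0 : 0 < q := by positivity
  -- Equality of the integrals makes `ρ(z/t) = ρ(z/s)` almost everywhere, and scaling preserves null
  -- sets. So `ρ` is constant along almost every geometric sequence of ratio `t/s`; its limit there
  -- is 1, which forces `g ρ t = 1`.
  have hscale : ∀ n : ℕ, ∀ᵐ z : ℝ, ρ (z * q ^ n / t) = ρ (z * q ^ n / s) := by
    intro n
    have hn : q ^ n ≠ 0 := by positivity
    have hqmp : Measure.QuasiMeasurePreserving (fun z : ℝ => z * q ^ n) volume volume := by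
      refine ⟨by fun_prop, ?_⟩
      rw [Real.map_volume_mul_right hn]
      exact Measure.smul_absolutelyContinuous
    exact hqmp.ae hvol
  have hconst : ∀ᵐ z ∂(gaussianReal 0 1), ρ (z / t) = 1 := by
    have hall := (gaussianReal_absolutelyContinuous 0 one_ne_zero).ae_le (ae_all_iff.2 hscale)
    filter_upwards [hall, ae_ne_zero] with z hz hz0
    have hn : ∀ n : ℕ, ρ (z * q ^ n / t) = ρ (z / t) := by
      intro n
      induction n with
      | zero => simp
      | succ n ih =>
        rw [← ih, hz n]
        congr 1
        rw [pow_succ, hq]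
        field_simp
    have hlim : Tendsto (fun n : ℕ => ρ (z * q ^ n / t)) atTop (𝓝 1) := by
      have : Tendsto (fun n : ℕ => |z| / t * q ^ n) atTop atTop :=
        Tendsto.const_mul_atTop (by positivity) (tendsto_pow_atTop_atTop_of_one_lt hq1)
      refine (hρ.tendsto_one.comp this).congr fun n => ?_
      rw [Function.comp_apply, ← hρ.apply_abs (z * q ^ n / t), abs_div, abs_mul,
        abs_of_pos ht, abs_of_pos (pow_pos hq0 n)]
      congr 1
      ring
    simp only [hn] at hlim
    exact tendsto_nhds_unique tendsto_const_nhds hlim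
  rw [g, integral_congr_ae hconst]
  simp

/-- The value 1 means `ρ = 1` almost everywhere, a property that does not depend on the scale. -/
theorem g_eq_one_of_g_eq_one (hρ : IsLoss ρ) {s t : ℝ} (hs : 0 < s) (ht : 0 < t)
    (h : g ρ s = 1) : g ρ t = 1 := by
  have hae : ∀ᵐ z ∂(gaussianReal 0 1), ρ (z / s) = 1 :=
    (integral_eq_iff_of_ae_le (hρ.integrable _ (by fun_prop)) (integrable_const 1)
      (Eventually.of_forall fun z => hρ.le_one _)).1 (by simpa [g] using h)
  have hvol : ∀ᵐ z : ℝ, ρ (z / s) = 1 :=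
    (gaussianReal_absolutelyContinuous' 0 one_ne_zero).ae_le hae
  have hq : s / t ≠ 0 := (div_pos hs ht).ne'
  have hqmp : Measure.QuasiMeasurePreserving (fun z : ℝ => z * (s / t)) volume volume := by
    refine ⟨by fun_prop, ?_⟩
    rw [Real.map_volume_mul_right hq]
    exact Measure.smul_absolutelyContinuous
  have hvol' : ∀ᵐ z ∂(gaussianReal 0 1), ρ (z * (s / t) / s) = 1 :=
    (gaussianReal_absolutelyContinuous 0 one_ne_zero).ae_le (hqmp.ae hvol)
  have hconst : ∀ᵐ z ∂(gaussianReal 0 1), ρ (z / t) = 1 := by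
    filter_upwards [hvol'] with z hz
    rw [← hz]
    congr 1
    field_simp
  rw [g, integral_congr_ae hconst]
  simp

theorem le_of_g_le (hρ : IsLoss ρ) {s t : ℝ} (hs : 0 < s) (h1 : g ρ t < 1)
    (h : g ρ s ≤ g ρ t) : t ≤ s := by
  by_contra! hlt
  exact (hρ.g_lt_g hs hlt h1).not_ge h

theorem exists_g_eq (hρ : IsLoss ρ) (hc : ContinuousOn (g ρ) (Ioi 0)) {v s : ℝ} (hs : 0 < s)
    (hsv : g ρ s ≤ v) (hv : v < 1) : ∃ t, 0 < t ∧ g ρ t = v := by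
  obtain ⟨r, hr, hr0, hrs⟩ := ((hρ.tendsto_g_zero.eventually_const_lt hv).and
    (Ioo_mem_nhdsGT hs)).exists
  obtain ⟨t, ht, hgt⟩ := intermediate_value_Icc' hrs.le
    (hc.mono fun x hx => hr0.trans_le hx.1) ⟨hsv, hr.le⟩
  exact ⟨t, hr0.trans_le ht.1, hgt⟩

/-- The expected loss at a noncentral normal variable with standard deviation `τ`. -/
theorem g_le_integral_sub (hρ : IsLoss ρ) {s τ : ℝ} (hs : 0 < s) (hτ : 0 < τ) (a : ℝ) :
    g ρ (s / τ) ≤ ∫ z, ρ ((τ * z - a) / s) ∂(gaussianReal 0 1) := by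
  have h := integral_gaussianReal_le_integral_sub (f := fun z => ρ (z / (s / τ)))
    (hρ.measurable.comp (by fun_prop)) (fun u => hρ.abs_le_one _)
    (fun u v huv => hρ.le_of_abs_le (by
      rw [abs_div u, abs_div v]
      exact div_le_div_of_nonneg_right huv (abs_nonneg _))) (a / τ)
  refine h.trans (le_of_eq ?_)
  congr 1
  ext z
  congr 1
  field_simp

end IsLoss

end MaxBias

/-! ### Mean loss under contamination and at an exact fit -/

namespace MaxBias

variable {p : ℕ} {ρ : ℝ → ℝ} {b c ε : ℝ} {H Hs : Measure (Obs p)}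

instance isProbabilityMeasure_gaussianModel (p : ℕ) : IsProbabilityMeasure (gaussianModel p) := by
  unfold gaussianModel
  infer_instance

theorem isProbabilityMeasure_contaminated (h0 : 0 ≤ ε) (h1 : ε ≤ 1) [IsProbabilityMeasure Hs] :
    IsProbabilityMeasure (contaminated p ε Hs) := by
  constructor
  simp [contaminated, ← ENNReal.ofReal_add (sub_nonneg.2 h1) h0]

theorem measurable_residual (α : ℝ) (θ : EuclideanSpace ℝ (Fin p)) (s : ℝ) :
    Measurable fun z : Obs p => (z.1 - α - inner ℝ z.2 θ) / s := by
  fun_prop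

theorem IsLoss.meanLoss_nonneg (hρ : IsLoss ρ) (α : ℝ) (θ : EuclideanSpace ℝ (Fin p)) (s : ℝ) :
    0 ≤ meanLoss ρ H α θ s := hρ.integral_nonneg _ _

theorem IsLoss.meanLoss_contaminated (hρ : IsLoss ρ) (h0 : 0 ≤ ε) (h1 : ε ≤ 1)
    [IsProbabilityMeasure Hs] (α : ℝ) (θ : EuclideanSpace ℝ (Fin p)) (s : ℝ) :
    meanLoss ρ (contaminated p ε Hs) α θ s =
      (1 - ε) * meanLoss ρ (gaussianModel p) α θ s + ε * meanLoss ρ Hs α θ s := by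
  unfold meanLoss contaminated
  rw [integral_add_measure, integral_smul_measure, integral_smul_measure,
    ENNReal.toReal_ofReal (sub_nonneg.2 h1), ENNReal.toReal_ofReal h0, smul_eq_mul, smul_eq_mul]
  · exact (hρ.integrable _ (measurable_residual α θ s)).smul_measure ENNReal.ofReal_ne_top
  · exact (hρ.integrable _ (measurable_residual α θ s)).smul_measure ENNReal.ofReal_ne_top

theorem IsLoss.meanLoss_gaussianModel (hρ : IsLoss ρ) (α : ℝ) (θ : EuclideanSpace ℝ (Fin p))
    (s : ℝ) : meanLoss ρ (gaussianModel p) α θ s =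
      ∫ z, ρ ((√(1 + ‖θ‖ ^ 2) * z - α) / s) ∂(gaussianReal 0 1) := by
  rw [← integral_gaussianModel_residual p θ (f := fun u => ρ ((u - α) / s))
    (hρ.measurable.comp (by fun_prop)), meanLoss]
  congr 1
  ext z
  ring_nf

theorem sqrt_one_add_sq_pos (r : ℝ) : 0 < √(1 + r ^ 2) := Real.sqrt_pos.2 (by positivity)

theorem one_le_sqrt_one_add_sq (r : ℝ) : 1 ≤ √(1 + r ^ 2) :=
  Real.one_le_sqrt.2 (by nlinarith [sq_nonneg r])

theorem IsLoss.g_le_meanLoss_gaussianModel (hρ : IsLoss ρ) (α : ℝ)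
    (θ : EuclideanSpace ℝ (Fin p)) {s : ℝ} (hs : 0 < s) :
    g ρ (s / √(1 + ‖θ‖ ^ 2)) ≤ meanLoss ρ (gaussianModel p) α θ s := by
  rw [hρ.meanLoss_gaussianModel]
  exact hρ.g_le_integral_sub hs (sqrt_one_add_sq_pos _) α

theorem IsLoss.meanLoss_gaussianModel_zero (hρ : IsLoss ρ) (θ : EuclideanSpace ℝ (Fin p))
    (s : ℝ) : meanLoss ρ (gaussianModel p) 0 θ s = g ρ (s / √(1 + ‖θ‖ ^ 2)) := by
  rw [hρ.meanLoss_gaussianModel, g]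
  congr 1
  ext z
  rw [sub_zero, mul_comm, div_div_eq_mul_div]

/-- The part of the mean loss that stems from the Gaussian model is at least the one at a
centered residual. -/
theorem IsLoss.mul_g_le_meanLoss_contaminated (hρ : IsLoss ρ) (h0 : 0 ≤ ε) (h1 : ε ≤ 1)
    [IsProbabilityMeasure Hs] (α : ℝ) (θ : EuclideanSpace ℝ (Fin p)) {s : ℝ} (hs : 0 < s) :
    (1 - ε) * g ρ (s / √(1 + ‖θ‖ ^ 2)) ≤ meanLoss ρ (contaminated p ε Hs) α θ s := by
  rw [hρ.meanLoss_contaminated h0 h1]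
  have := mul_le_mul_of_nonneg_left (hρ.g_le_meanLoss_gaussianModel α θ hs) (sub_nonneg.2 h1)
  have := mul_nonneg h0 (hρ.meanLoss_nonneg (H := Hs) α θ s)
  linarith

/-- The distribution of `(n x'θ, n x)` for a standard normal `x`: an exact fit with slopes `θ`
and regressors spread out at scale `n`. -/
noncomputable def exactFit (n : ℝ) (θ : EuclideanSpace ℝ (Fin p)) : Measure (Obs p) :=
  (stdGaussian (EuclideanSpace ℝ (Fin p))).map fun x => (n * inner ℝ x θ, n • x)

instance isProbabilityMeasure_exactFit (n : ℝ) (θ : EuclideanSpace ℝ (Fin p)) :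
    IsProbabilityMeasure (exactFit n θ) :=
  Measure.isProbabilityMeasure_map (by fun_prop)

theorem IsLoss.meanLoss_exactFit (hρ : IsLoss ρ) {n : ℝ} (hn : 0 < n)
    (θ₀ : EuclideanSpace ℝ (Fin p)) (α : ℝ) (θ : EuclideanSpace ℝ (Fin p)) (s : ℝ) :
    meanLoss ρ (exactFit n θ₀) α θ s =
      ∫ z, ρ ((n * ‖θ₀ - θ‖ * z - α) / s) ∂(gaussianReal 0 1) := by
  have hm : Measurable fun z : Obs p => ρ ((z.1 - α - inner ℝ z.2 θ) / s) :=
    hρ.measurable.comp (measurable_residual α θ s)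
  rw [meanLoss, exactFit, integral_map (by fun_prop) hm.aestronglyMeasurable]
  have h := integral_stdGaussian_inner (n • (θ₀ - θ)) (f := fun u => ρ ((u - α) / s))
    (hρ.measurable.comp (by fun_prop))
  rw [norm_smul, Real.norm_of_nonneg hn.le] at h
  rw [← h]
  congr 1
  ext x
  simp only [inner_smul_right, inner_smul_left, inner_sub_right, RCLike.conj_to_real]
  ring_nf

theorem IsLoss.meanLoss_exactFit_self (hρ : IsLoss ρ) {n : ℝ} (hn : 0 < n)
    (θ : EuclideanSpace ℝ (Fin p)) (s : ℝ) : meanLoss ρ (exactFit n θ) 0 θ s = 0 := by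
  rw [hρ.meanLoss_exactFit hn]
  simp [hρ.zero]

/-- The residual `n x'(θ₀-θ)` has standard deviation at least `n δ`, and shifting it by `α` only
increases the mean loss. For large `n` the bound is close to 1, uniformly in `α` and in `θ` outside
the `δ`-ball around `θ₀`. -/
theorem IsLoss.g_le_meanLoss_exactFit (hρ : IsLoss ρ) {n δ s : ℝ} (hn : 0 < n) (hδ : 0 < δ)
    (hs : 0 < s) (θ₀ : EuclideanSpace ℝ (Fin p)) (α : ℝ) (θ : EuclideanSpace ℝ (Fin p))
    (hθ : δ ≤ ‖θ₀ - θ‖) : g ρ (s / (n * δ)) ≤ meanLoss ρ (exactFit n θ₀) α θ s := by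
  rw [hρ.meanLoss_exactFit hn]
  have hpos : 0 < ‖θ₀ - θ‖ := hδ.trans_le hθ
  refine le_trans (hρ.g_antitoneOn ?_ ?_ ?_) (hρ.g_le_integral_sub hs (mul_pos hn hpos) α)
  · exact div_pos hs (mul_pos hn hpos)
  · exact div_pos hs (mul_pos hn hδ)
  · gcongr

/-! ### Reduction of the S-estimate to the CM-estimate -/

section Objective

variable {α : ℝ} {θ : EuclideanSpace ℝ (Fin p)}

theorem objCM_le_of_feasible {s : ℝ} (hs : s ∈ feasibleScales ρ b H α θ) :
    objCM ρ b c H α θ ≤ ((c * meanLoss ρ H α θ s + Real.log s : ℝ) : EReal) :=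
  iInf₂_le s hs

theorem le_objCM {v : EReal} (h : ∀ s ∈ feasibleScales ρ b H α θ,
    v ≤ ((c * meanLoss ρ H α θ s + Real.log s : ℝ) : EReal)) : v ≤ objCM ρ b c H α θ :=
  le_iInf₂ h

theorem objCM_lt_top_iff : objCM ρ b c H α θ < ⊤ ↔ (feasibleScales ρ b H α θ).Nonempty := by
  constructor
  · intro h
    by_contra hne
    rw [not_nonempty_iff_eq_empty] at hne
    simp [objCM, hne] at h
  · rintro ⟨s, hs⟩
    exact (objCM_le_of_feasible hs).trans_lt (EReal.coe_lt_top _)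

theorem objS_lt_top_iff : objS ρ b H α θ < ⊤ ↔ (feasibleScales ρ b H α θ).Nonempty := by
  constructor
  · intro h
    by_contra hne
    rw [not_nonempty_iff_eq_empty] at hne
    simp [objS, hne] at h
  · rintro ⟨s, hs⟩
    exact (iInf₂_le s hs).trans_lt (EReal.coe_lt_top _)

/-- Infima that may be infinite or unattained are compared through real thresholds only, so that a
strictly increasing change of variable such as `log` carries over. -/
theorem iInf_coe_le_iInf_coe_iff {A B : Set ℝ} {f : ℝ → ℝ} :
    (⨅ s ∈ A, (f s : EReal)) ≤ ⨅ s ∈ B, (f s : EReal) ↔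
      ∀ s ∈ B, ∀ t, f s < t → ∃ r ∈ A, f r < t := by
  constructor
  · intro h s hs t hst
    have h2 : (⨅ s ∈ A, (f s : EReal)) < (t : EReal) :=
      (h.trans (iInf₂_le s hs)).trans_lt (EReal.coe_lt_coe_iff.2 hst)
    simp only [iInf_lt_iff] at h2
    obtain ⟨r, hr, hrt⟩ := h2
    exact ⟨r, hr, EReal.coe_lt_coe_iff.1 hrt⟩
  · intro h
    refine le_iInf₂ fun s hs => EReal.le_of_forall_lt_iff_le.1 fun t ht => ?_
    obtain ⟨r, hr, hrt⟩ := h s hs t (EReal.coe_lt_coe_iff.1 ht)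
    exact (iInf₂_le r hr).trans (EReal.coe_lt_coe_iff.2 hrt).le

theorem iInf_coe_le_iff_iInf_log_le {A B : Set ℝ} (hA : A ⊆ Ioi 0) (hB : B ⊆ Ioi 0) :
    (⨅ s ∈ A, (s : EReal)) ≤ ⨅ s ∈ B, (s : EReal) ↔
      (⨅ s ∈ A, (Real.log s : EReal)) ≤ ⨅ s ∈ B, (Real.log s : EReal) := by
  rw [iInf_coe_le_iInf_coe_iff (f := fun s => s), iInf_coe_le_iInf_coe_iff]
  constructor
  · intro h s hs t hst
    obtain ⟨r, hr, hrt⟩ := h s hs (Real.exp t) ((Real.log_lt_iff_lt_exp (hB hs)).1 hst)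
    exact ⟨r, hr, (Real.log_lt_iff_lt_exp (hA hr)).2 hrt⟩
  · intro h s hs t hst
    have ht : 0 < t := lt_trans (hB hs) hst
    obtain ⟨r, hr, hrt⟩ := h s hs (Real.log t) (Real.log_lt_log (hB hs) hst)
    exact ⟨r, hr, (Real.log_lt_log_iff (hA hr) ht).1 hrt⟩

/-- The S-estimate is the CM-estimate with tuning constant `0`. -/
theorem slopeMinimizers_objS : slopeMinimizers (objS ρ b H) = slopeMinimizers (objCM ρ b 0 H) := by
  have key : ∀ α α' θ θ', objS ρ b H α θ ≤ objS ρ b H α' θ' ↔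
      objCM ρ b 0 H α θ ≤ objCM ρ b 0 H α' θ' := by
    intro α α' θ θ'
    simp only [objS, objCM, zero_mul, zero_add]
    exact iInf_coe_le_iff_iInf_log_le (fun s hs => hs.1) fun s hs => hs.1
  ext θ
  simp only [slopeMinimizers, mem_ofPred_eq, objS_lt_top_iff, objCM_lt_top_iff, key]

theorem IsSEstimate.isCMEstimate {T : Measure (Obs p) → Option (EuclideanSpace ℝ (Fin p))}
    (hT : IsSEstimate ρ b T) : IsCMEstimate ρ b 0 T := by
  intro H hH
  rw [← slopeMinimizers_objS]
  exact hT H hH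

end Objective

/-! ### Lower bounds for the bias from one better competitor -/

section Bias

variable {T : Measure (Obs p) → Option (EuclideanSpace ℝ (Fin p))}

theorem bias_le_maxBias (T : Measure (Obs p) → Option (EuclideanSpace ℝ (Fin p)))
    (Hs : Measure (Obs p)) [h : IsProbabilityMeasure Hs] :
    bias T (contaminated p ε Hs) ≤ maxBias T ε :=
  le_iSup₂ (f := fun (Hs : Measure (Obs p)) (_ : IsProbabilityMeasure Hs) =>
    bias T (contaminated p ε Hs)) Hs h

theorem IsCMEstimate.le_bias (hT : IsCMEstimate ρ b c T) [IsProbabilityMeasure H] {R : ℝ}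
    {α₀ : ℝ} {θ₀ : EuclideanSpace ℝ (Fin p)}
    (h : ∀ α θ, ‖θ‖ ≤ R → objCM ρ b c H α₀ θ₀ < objCM ρ b c H α θ) :
    ENNReal.ofReal R ≤ bias T H := by
  unfold bias
  cases hTH : T H with
  | none => exact le_top
  | some θ =>
    obtain ⟨α, -, hmin⟩ := (hT H inferInstance).1 θ hTH
    have : R < ‖θ‖ := by
      by_contra! hle
      exact (hmin α₀ θ₀).not_gt (h α θ hle)
    simp only [← ofReal_norm]
    exact ENNReal.ofReal_le_ofReal this.le

theorem IsCMEstimate.bias_eq_top (hT : IsCMEstimate ρ b c T) [IsProbabilityMeasure H]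
    (h : ∀ α θ, feasibleScales ρ b H α θ = ∅) : bias T H = ⊤ := by
  unfold bias
  cases hTH : T H with
  | none => rfl
  | some θ =>
    obtain ⟨α, hlt, -⟩ := (hT H inferInstance).1 θ hTH
    rw [objCM_lt_top_iff, h] at hlt
    exact absurd hlt not_nonempty_empty

/-- A one-dimensional criterion for a lower bound of the maximum bias: contaminate with an exact
fit whose slopes have norm `t > R` and whose regressors are spread out. -/
theorem IsCMEstimate.le_maxBias (hp : 1 ≤ p) (hρ : IsLoss ρ) (hc : 0 ≤ c)
    (hT : IsCMEstimate ρ b c T) (h0 : 0 ≤ ε) (h1 : ε ≤ 1) {R t k s₀ V : ℝ} (hR : 0 ≤ R)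
    (hRt : R < t) (hk : 0 < k) (hs₀ : 0 < s₀) (hfeas : (1 - ε) * g ρ (s₀ / √(1 + t ^ 2)) ≤ b)
    (hval : c * ((1 - ε) * g ρ (s₀ / √(1 + t ^ 2))) + Real.log s₀ < V)
    (hall : ∀ s, 0 < s → (1 - ε) * g ρ s + ε * g ρ (s / k) ≤ b →
      V ≤ c * ((1 - ε) * g ρ s + ε * g ρ (s / k)) + Real.log s) :
    ENNReal.ofReal R ≤ maxBias T ε := by
  have ht : 0 ≤ t := hR.trans hRt.le
  have : Nonempty (Fin p) := ⟨⟨0, hp⟩⟩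
  obtain ⟨θ₀, hθ₀⟩ : ∃ θ₀ : EuclideanSpace ℝ (Fin p), ‖θ₀‖ = t := exists_norm_eq _ ht
  have hδ : 0 < t - R := sub_pos.2 hRt
  -- Slopes of norm at most `R` are at distance at least `t - R` from `θ₀`, so this spread gives
  -- their exact-fit residuals standard deviation at least `k`. The number `V` then separates the
  -- objective at `θ₀` from that at all such slopes.
  set n : ℝ := k / (t - R) with hn_def
  have hn : 0 < n := div_pos hk hδ
  have hnk : n * (t - R) = k := div_mul_cancel₀ _ hδ.ne'
  have hprob : IsProbabilityMeasure (contaminated p ε (exactFit n θ₀)) :=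
    isProbabilityMeasure_contaminated h0 h1
  refine (hT.le_bias (α₀ := 0) (θ₀ := θ₀) fun α θ hθ => ?_).trans
    (bias_le_maxBias T (exactFit n θ₀))
  have hL₀ : meanLoss ρ (contaminated p ε (exactFit n θ₀)) 0 θ₀ s₀ =
      (1 - ε) * g ρ (s₀ / √(1 + t ^ 2)) := by
    rw [hρ.meanLoss_contaminated h0 h1, hρ.meanLoss_gaussianModel_zero,
      hρ.meanLoss_exactFit_self hn, hθ₀, mul_zero, add_zero]
  have hlt : objCM ρ b c (contaminated p ε (exactFit n θ₀)) 0 θ₀ < (V : EReal) := by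
    refine (objCM_le_of_feasible (s := s₀) ⟨hs₀, ?_⟩).trans_lt ?_
    · rwa [hL₀]
    · rw [hL₀]
      exact EReal.coe_lt_coe_iff.2 hval
  refine hlt.trans_le (le_objCM fun s hs => EReal.coe_le_coe_iff.2 ?_)
  have hs0 : 0 < s := hs.1
  have hL : (1 - ε) * g ρ s + ε * g ρ (s / k) ≤
      meanLoss ρ (contaminated p ε (exactFit n θ₀)) α θ s := by
    rw [hρ.meanLoss_contaminated h0 h1]
    refine add_le_add (mul_le_mul_of_nonneg_left ?_ (sub_nonneg.2 h1))
      (mul_le_mul_of_nonneg_left ?_ h0)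
    · refine le_trans (hρ.g_antitoneOn ?_ hs0 ?_) (hρ.g_le_meanLoss_gaussianModel α θ hs0)
      · exact div_pos hs0 (sqrt_one_add_sq_pos _)
      · exact div_le_self hs0.le (one_le_sqrt_one_add_sq _)
    · rw [← hnk]
      refine hρ.g_le_meanLoss_exactFit hn hδ hs0 θ₀ α θ ?_
      have := norm_sub_norm_le θ₀ θ
      linarith
  refine (hall s hs0 (hL.trans hs.2)).trans ?_
  gcongr

end Bias

end MaxBias

/-! ### Existence of minimizers -/

namespace MaxBias

variable {p : ℕ} {ρ : ℝ → ℝ} {b c ε : ℝ} {H Hs : Measure (Obs p)}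

/-- The mean loss is lower semicontinuous up to an arbitrarily small increase of the scale. -/
theorem IsLoss.meanLoss_le_of_tendsto (hρ : IsLoss ρ) [IsFiniteMeasure H]
    {αs : ℕ → ℝ} {θs : ℕ → EuclideanSpace ℝ (Fin p)} {ss : ℕ → ℝ}
    {α : ℝ} {θ : EuclideanSpace ℝ (Fin p)} {s s' l : ℝ}
    (hα : Tendsto αs atTop (𝓝 α)) (hθ : Tendsto θs atTop (𝓝 θ)) (hs : Tendsto ss atTop (𝓝 s))
    (hs0 : 0 < s) (hss' : s < s')
    (hl : Tendsto (fun n => meanLoss ρ H (αs n) (θs n) (ss n)) atTop (𝓝 l)) :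
    meanLoss ρ H α θ s' ≤ l := by
  have hρm : ∀ α θ s, Measurable fun z : Obs p => ρ ((z.1 - α - inner ℝ z.2 θ) / s) :=
    fun α θ s => hρ.measurable.comp (measurable_residual α θ s)
  -- Since `ρ` may be discontinuous, the limit is taken at a larger scale `s'`: a nonzero limiting
  -- residual divided by `s'` is strictly smaller than when divided by `s`, so the minimum
  -- eventually equals its second term. At residual 0 this holds because `ρ 0 = 0`.
  have hlim : Tendsto (fun n => ∫ z, min (ρ ((z.1 - αs n - inner ℝ z.2 (θs n)) / ss n))
      (ρ ((z.1 - α - inner ℝ z.2 θ) / s')) ∂H) atTop (𝓝 (meanLoss ρ H α θ s')) := by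
    refine tendsto_integral_of_dominated_convergence (fun _ => 1)
      (fun n => ((hρm _ _ _).min (hρm _ _ _)).aestronglyMeasurable) (integrable_const _)
      (fun n => Eventually.of_forall fun z => ?_) (Eventually.of_forall fun z => ?_)
    · rw [Real.norm_of_nonneg (le_min (hρ.nonneg _) (hρ.nonneg _))]
      exact (min_le_left _ _).trans (hρ.le_one _)
    · refine tendsto_const_nhds.congr' ?_
      set r := z.1 - α - inner ℝ z.2 θ with hr
      rcases eq_or_ne r 0 with h0 | h0
      · refine Eventually.of_forall fun n => ?_
        simp only [h0, zero_div, hρ.zero]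
        exact (min_eq_right (hρ.nonneg _)).symm
      · have hrs : Tendsto (fun n => |(z.1 - αs n - inner ℝ z.2 (θs n)) / ss n|) atTop
            (𝓝 |r / s|) :=
          (((tendsto_const_nhds.sub hα).sub
            (tendsto_const_nhds.inner hθ)).div hs hs0.ne').abs
        have hlt : |r / s'| < |r / s| := by
          rw [abs_div, abs_div, abs_of_pos hs0, abs_of_pos (hs0.trans hss')]
          exact div_lt_div_of_pos_left (abs_pos.2 h0) hs0 hss'
        filter_upwards [hrs.eventually_const_lt hlt] with n hn
        rw [min_eq_right (hρ.le_of_abs_le hn.le)]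
  refine le_of_tendsto_of_tendsto' hlim hl fun n => ?_
  refine integral_mono ?_ (hρ.integrable H (measurable_residual _ _ _)) fun z => min_le_left _ _
  exact (hρ.integrable H (measurable_residual _ _ _)).inf
    (hρ.integrable H (measurable_residual _ _ _))

/-- With bounded slopes and scales, a feasible intercept is bounded. -/
theorem IsLoss.exists_forall_lt_meanLoss (hρ : IsLoss ρ) [IsProbabilityMeasure H] {v : ℝ}
    (hv : v < 1) (M : ℝ) {S : ℝ} (hS : 0 < S) :
    ∃ A, ∀ (α : ℝ) (θ : EuclideanSpace ℝ (Fin p)) (s : ℝ), ‖θ‖ ≤ M → 0 < s → s ≤ S → A ≤ |α| →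
      v < meanLoss ρ H α θ s := by
  -- For `|α| = a` this is a lower bound of the absolute scaled residual, uniform over the allowed
  -- slopes and scales. The positive part is needed because `ρ` is even.
  have hm : ∀ a : ℝ, Measurable fun z : Obs p => max (a - |z.1| - M * ‖z.2‖) 0 / S := by
    intro a
    fun_prop
  have hlim : Tendsto (fun a : ℝ => ∫ z : Obs p, ρ (max (a - |z.1| - M * ‖z.2‖) 0 / S) ∂H) atTop
      (𝓝 1) := by
    refine hρ.tendsto_integral_one H hm (Eventually.of_forall fun z => ?_)
    have h1 : Tendsto (fun a : ℝ => (a - |z.1| - M * ‖z.2‖) / S) atTop atTop := by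
      refine Tendsto.atTop_div_const hS ?_
      simp only [sub_eq_add_neg]
      exact tendsto_atTop_add_const_right _ _ (tendsto_atTop_add_const_right _ _ tendsto_id)
    refine tendsto_atTop_mono (fun a => ?_) h1
    refine le_trans ?_ (le_abs_self _)
    gcongr
    exact le_max_left _ _
  obtain ⟨A, hA⟩ := eventually_atTop.1 (hlim.eventually_const_lt hv)
  refine ⟨A, fun α θ s hθ hs hsS hα => (hA _ hα).trans_le ?_⟩
  refine hρ.integral_mono_abs H (hm _) (measurable_residual α θ s) fun z => ?_
  rw [abs_div, abs_div, abs_of_pos hS, abs_of_pos hs, abs_of_nonneg (le_max_right _ _)]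
  refine div_le_div₀ (abs_nonneg _) (max_le ?_ (abs_nonneg _)) hs hsS
  have h1 : |(inner ℝ z.2 θ : ℝ)| ≤ M * ‖z.2‖ := by
    refine (abs_real_inner_le_norm _ _).trans ?_
    rw [mul_comm]
    gcongr
  have h2 : |α| ≤ |z.1 - α - inner ℝ z.2 θ| + |z.1| + |(inner ℝ z.2 θ : ℝ)| := by
    have e : α = -(z.1 - α - inner ℝ z.2 θ) + z.1 + -inner ℝ z.2 θ := by ring
    calc |α| = |-(z.1 - α - inner ℝ z.2 θ) + z.1 + -inner ℝ z.2 θ| := congrArg _ e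
      _ ≤ _ := (abs_add_three _ _ _).trans (by rw [abs_neg, abs_neg])
  linarith

/-- The Gaussian part alone must respect the constraint, so `g(s/√(1+‖θ‖²)) ≤ g(γ)`, and `g` is
strictly decreasing below 1. -/
theorem IsLoss.scale_le_of_feasible (hρ : IsLoss ρ) (h0 : 0 ≤ ε) (h1 : ε < 1)
    [IsProbabilityMeasure Hs] {γ : ℝ} (hγ : (1 - ε) * g ρ γ = b) (hγ1 : g ρ γ < 1)
    {α : ℝ} {θ : EuclideanSpace ℝ (Fin p)} {s : ℝ}
    (hs : s ∈ feasibleScales ρ b (contaminated p ε Hs) α θ) :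
    γ * √(1 + ‖θ‖ ^ 2) ≤ s := by
  have h := (hρ.mul_g_le_meanLoss_contaminated h0 h1.le α θ hs.1).trans hs.2
  rw [← hγ, mul_le_mul_iff_right₀ (sub_pos.2 h1)] at h
  rw [← le_div_iff₀ (sqrt_one_add_sq_pos _)]
  exact hρ.le_of_g_le (div_pos hs.1 (sqrt_one_add_sq_pos _)) hγ1 h

theorem norm_le_sqrt_one_add_sq {E : Type*} [SeminormedAddGroup E] (x : E) :
    ‖x‖ ≤ √(1 + ‖x‖ ^ 2) := Real.le_sqrt_of_sq_le (by linarith)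

/-- Direct method. Along a minimizing sequence the logarithm bounds the scale above, feasibility
bounds it below and bounds the slopes, and the Gaussian part bounds the intercept. -/
theorem IsLoss.slopeMinimizers_nonempty (hρ : IsLoss ρ) (hc : 0 ≤ c) (h0 : 0 ≤ ε) (h1 : ε < 1)
    [IsProbabilityMeasure Hs] {γ : ℝ} (hγ0 : 0 < γ) (hγ : (1 - ε) * g ρ γ = b)
    (hγ1 : g ρ γ < 1) {α₁ : ℝ} {θ₁ : EuclideanSpace ℝ (Fin p)}
    (hfeas : (feasibleScales ρ b (contaminated p ε Hs) α₁ θ₁).Nonempty) :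
    (slopeMinimizers (objCM ρ b c (contaminated p ε Hs))).Nonempty := by
  set H := contaminated p ε Hs with hH
  have hprob : IsProbabilityMeasure H := isProbabilityMeasure_contaminated h0 h1.le
  have hscale : ∀ {α θ s}, s ∈ feasibleScales ρ b H α θ → γ * √(1 + ‖θ‖ ^ 2) ≤ s :=
    fun hs => hρ.scale_le_of_feasible h0 h1 hγ hγ1 hs
  have hscale' : ∀ {α θ s}, s ∈ feasibleScales ρ b H α θ → γ ≤ s := fun hs =>
    (le_mul_of_one_le_right hγ0.le (one_le_sqrt_one_add_sq _)).trans (hscale hs)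
  set W : Set ℝ := {v | ∃ α θ s, s ∈ feasibleScales ρ b H α θ ∧
    c * meanLoss ρ H α θ s + Real.log s = v} with hW
  have hlogW : ∀ {α θ s}, Real.log s ≤ c * meanLoss ρ H α θ s + Real.log s :=
    le_add_of_nonneg_left (mul_nonneg hc (hρ.meanLoss_nonneg _ _ _))
  have hWne : W.Nonempty := by
    obtain ⟨s, hs⟩ := hfeas
    exact ⟨_, α₁, θ₁, s, hs, rfl⟩
  have hWbdd : BddBelow W := by
    refine ⟨Real.log γ, ?_⟩
    rintro v ⟨α, θ, s, hs, rfl⟩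
    exact (Real.log_le_log hγ0 (hscale' hs)).trans hlogW
  obtain ⟨v, -, hvlim, hvW⟩ := exists_seq_tendsto_sInf hWne hWbdd
  choose αs θs ss hss hval using hvW
  obtain ⟨M, hM⟩ := hvlim.bddAbove_range
  have hsM : ∀ n, ss n ≤ Real.exp M := fun n => by
    rw [← Real.log_le_iff_le_exp (hss n).1]
    exact hlogW.trans ((hval n).le.trans (hM ⟨n, rfl⟩))
  have hθM : ∀ n, ‖θs n‖ ≤ Real.exp M / γ := fun n => by
    rw [le_div_iff₀' hγ0]
    exact (mul_le_mul_of_nonneg_left (norm_le_sqrt_one_add_sq _) hγ0.le).trans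
      ((hscale (hss n)).trans (hsM n))
  obtain ⟨A, hA⟩ := hρ.exists_forall_lt_meanLoss (H := gaussianModel p) hγ1 (Real.exp M / γ)
    (Real.exp_pos M)
  have hαA : ∀ n, |αs n| ≤ A := fun n => by
    by_contra! hlt
    have hlt' := hA (αs n) (θs n) (ss n) (hθM n) (hss n).1 (hsM n) hlt.le
    have hle := (hss n).2
    rw [hH, hρ.meanLoss_contaminated h0 h1.le, ← hγ] at hle
    have := mul_lt_mul_of_pos_left hlt' (sub_pos.2 h1)
    have := mul_nonneg h0 (hρ.meanLoss_nonneg (H := Hs) (αs n) (θs n) (ss n))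
    linarith
  have hcomp : IsCompact (Icc (-A) A ×ˢ
      (Metric.closedBall (0 : EuclideanSpace ℝ (Fin p)) (Real.exp M / γ) ×ˢ
        (Icc γ (Real.exp M) ×ˢ Icc (0 : ℝ) b))) :=
    isCompact_Icc.prod ((isCompact_closedBall _ _).prod (isCompact_Icc.prod isCompact_Icc))
  -- The mean loss is a fourth coordinate so that it converges as well, to some `l ≤ b`. It need not
  -- be the mean loss at the limit point, but every scale above `s` has mean loss at most `l`;
  -- letting the scale decrease to `s` yields the infimum.
  obtain ⟨⟨α, θ, s, l⟩, hmem, φ, hφ, hlim⟩ := hcomp.tendsto_subseq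
    (x := fun n => (αs n, θs n, ss n, meanLoss ρ H (αs n) (θs n) (ss n)))
    (fun n => ⟨abs_le.1 (hαA n), by simpa using hθM n, ⟨hscale' (hss n), hsM n⟩,
      hρ.meanLoss_nonneg _ _ _, (hss n).2⟩)
  have hs0 : 0 < s := hγ0.trans_le hmem.2.2.1.1
  have hlb : l ≤ b := hmem.2.2.2.2
  have lα := hlim.fst_nhds
  have lθ := hlim.snd_nhds.fst_nhds
  have ls := hlim.snd_nhds.snd_nhds.fst_nhds
  have ll := hlim.snd_nhds.snd_nhds.snd_nhds
  have hm : c * l + Real.log s = sInf W := by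
    refine tendsto_nhds_unique ((ll.const_mul c).add (ls.log hs0.ne')) ?_
    refine (hvlim.comp hφ.tendsto_atTop).congr fun n => ?_
    exact (hval (φ n)).symm
  have hle : ∀ s', s < s' → meanLoss ρ H α θ s' ≤ l := fun s' hs' =>
    hρ.meanLoss_le_of_tendsto lα lθ ls hs0 hs' ll
  have hobj : objCM ρ b c H α θ ≤ (sInf W : ℝ) := by
    refine EReal.le_of_forall_lt_iff_le.1 fun t ht => ?_
    rw [EReal.coe_lt_coe_iff, ← hm] at ht
    have hcont : Tendsto (fun s' => c * l + Real.log s') (𝓝[>] s) (𝓝 (c * l + Real.log s)) :=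
      (tendsto_const_nhds.add (Real.continuousAt_log hs0.ne')).mono_left nhdsWithin_le_nhds
    obtain ⟨s', hs't, hs'⟩ := ((hcont.eventually_lt_const ht).and self_mem_nhdsWithin).exists
    refine (objCM_le_of_feasible (s := s') ⟨hs0.trans hs', (hle s' hs').trans hlb⟩).trans
      (EReal.coe_le_coe_iff.2 ?_)
    have := mul_le_mul_of_nonneg_left (hle s' hs') hc
    linarith
  refine ⟨θ, α, hobj.trans_lt (EReal.coe_lt_top _), fun α' θ' => hobj.trans ?_⟩
  exact le_objCM fun s' hs' => EReal.coe_le_coe_iff.2 (csInf_le hWbdd ⟨α', θ', s', hs', rfl⟩)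

end MaxBias

/-! ### Breakdown, and two-sided bounds for the maximum bias -/

namespace MaxBias

variable {p : ℕ} {ρ : ℝ → ℝ} {b c ε σ γ : ℝ} {Hs : Measure (Obs p)}
  {T : Measure (Obs p) → Option (EuclideanSpace ℝ (Fin p))}

theorem IsLoss.tendsto_g_div_atTop (hρ : IsLoss ρ) {s : ℝ} (hs : 0 < s) :
    Tendsto (fun k => g ρ (s / k)) atTop (𝓝 1) := by
  refine hρ.tendsto_g_zero.comp (tendsto_nhdsWithin_iff.2
    ⟨tendsto_const_nhds.div_atTop tendsto_id, ?_⟩)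
  filter_upwards [eventually_gt_atTop 0] with k hk
  exact div_pos hs hk

theorem eq_top_of_forall_ofReal_le {x : ENNReal} (h : ∀ R : ℝ, 0 ≤ R → ENNReal.ofReal R ≤ x) :
    x = ⊤ := by
  refine ENNReal.eq_top_of_forall_nnreal_le fun r => ?_
  simpa using h r r.2

/-- If the contamination alone satisfies the constraint, the estimate breaks down. -/
theorem IsCMEstimate.maxBias_eq_top_of_one_sub_le (hp : 1 ≤ p) (hρ : IsLoss ρ) (hb1 : b < 1)
    (hc : 0 ≤ c) (hT : IsCMEstimate ρ b c T) (h0 : 0 ≤ ε) (h1 : ε ≤ 1) (hbε : 1 - ε ≤ b) :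
    maxBias T ε = ⊤ := by
  refine eq_top_of_forall_ofReal_le fun R hR => ?_
  obtain ⟨s₁, hs₁, hg⟩ := mem_nhdsGT_iff_exists_Ioo_subset.1
    (hρ.tendsto_g_zero.eventually_const_lt hb1)
  have h1ε := sub_nonneg.2 h1
  have hle : ∀ s, (1 - ε) * g ρ s ≤ 1 - ε := fun s => mul_le_of_le_one_right h1ε (hρ.g_le_one s)
  -- At the exact fit every scale is feasible, so `s₀` can be chosen to push the value below `log
  -- s₁`. With `k = 1` the bound for the other slopes is `g(s) ≤ b`, which fails for `s < s₁`.
  refine hT.le_maxBias hp hρ hc h0 h1 hR (lt_add_one R) one_pos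
    (s₀ := Real.exp (Real.log s₁ - c - 1)) (V := Real.log s₁) (Real.exp_pos _)
    ((hle _).trans hbε) ?_ fun s hs hfeas => ?_
  · rw [Real.log_exp]
    have := mul_le_of_le_one_right hc ((hle (Real.exp (Real.log s₁ - c - 1) /
      √(1 + (R + 1) ^ 2))).trans (by linarith))
    linarith
  · rw [div_one, ← add_mul, sub_add_cancel, one_mul] at *
    have hs₁s : s₁ ≤ s := by
      by_contra! hlt
      exact (hg ⟨hs, hlt⟩ : b < g ρ s).not_ge hfeas
    exact (Real.log_le_log hs₁ hs₁s).trans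
      (le_add_of_nonneg_left (mul_nonneg hc (hρ.g_nonneg s)))

/-- If no scale is feasible, the estimate is undefined. -/
theorem IsCMEstimate.maxBias_eq_top_of_lt (hρ : IsLoss ρ) (hT : IsCMEstimate ρ b c T)
    (h0 : 0 ≤ ε) (h1 : ε ≤ 1) (h : ∀ s, 0 < s → b < (1 - ε) * g ρ s) : maxBias T ε = ⊤ := by
  have hprob : IsProbabilityMeasure (contaminated p ε (gaussianModel p)) :=
    isProbabilityMeasure_contaminated h0 h1
  refine top_le_iff.1 ((hT.bias_eq_top fun α θ => ?_).symm.le.trans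
    (bias_le_maxBias T (gaussianModel p)))
  refine eq_empty_of_forall_notMem fun s hs => ?_
  have := (hρ.mul_g_le_meanLoss_contaminated h0 h1 α θ hs.1).trans hs.2
  exact (h _ (div_pos hs.1 (sqrt_one_add_sq_pos _))).not_ge this

/-- If remote contamination violates the constraint at all scales, the estimate breaks down. -/
theorem IsCMEstimate.maxBias_eq_top_of_sub_lt (hp : 1 ≤ p) (hρ : IsLoss ρ) (hc : 0 ≤ c)
    (hT : IsCMEstimate ρ b c T) (h0 : 0 ≤ ε) (h1 : ε ≤ 1) (hγ0 : 0 < γ)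
    (hγ : (1 - ε) * g ρ γ = b) (h : ∀ s, 0 < s → b - ε < (1 - ε) * g ρ s) :
    maxBias T ε = ⊤ := by
  refine eq_top_of_forall_ofReal_le fun R hR => ?_
  have hτ := sqrt_one_add_sq_pos (R + 1)
  set s₀ := γ * √(1 + (R + 1) ^ 2) with hs₀
  have hs₀γ : s₀ / √(1 + (R + 1) ^ 2) = γ := mul_div_cancel_right₀ _ hτ.ne'
  -- The exact fit at scale `s₀` has mean loss `b`, hence value `V - 1`. For `k` large, slopes near
  -- 0 are infeasible at all scales below `exp V`, so their objective is at least `V`.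
  set V := c * b + Real.log s₀ + 1 with hV
  have hS := Real.exp_pos V
  have hlim : Tendsto (fun k => (1 - ε) * g ρ (Real.exp V) + ε * g ρ (Real.exp V / k)) atTop
      (𝓝 ((1 - ε) * g ρ (Real.exp V) + ε * 1)) :=
    tendsto_const_nhds.add ((hρ.tendsto_g_div_atTop hS).const_mul ε)
  have hbV : b < (1 - ε) * g ρ (Real.exp V) + ε * 1 := by linarith [h _ hS]
  obtain ⟨k, hk, hk0⟩ := ((hlim.eventually_const_lt hbV).and (eventually_gt_atTop 0)).exists
  refine hT.le_maxBias hp hρ hc h0 h1 hR (lt_add_one R) hk0 (mul_pos hγ0 hτ) (V := V)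
    (by rw [hs₀γ, hγ]) (by rw [hs₀γ, hγ]; linarith) fun s hs hfeas => ?_
  have h1ε := sub_nonneg.2 h1
  have hlog : V ≤ Real.log s := by
    rw [Real.le_log_iff_exp_le hs]
    by_contra! hlt
    have e1 := mul_le_mul_of_nonneg_left (hρ.g_antitoneOn hs hS hlt.le) h1ε
    have e2 := mul_le_mul_of_nonneg_left (hρ.g_antitoneOn (div_pos hs hk0) (div_pos hS hk0)
      (div_le_div_of_nonneg_right hlt.le hk0.le)) h0
    linarith
  refine hlog.trans (le_add_of_nonneg_left (mul_nonneg hc ?_))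
  exact add_nonneg (mul_nonneg h1ε (hρ.g_nonneg _)) (mul_nonneg h0 (hρ.g_nonneg _))

/-- The zero fit at scale `σ` is feasible even when the contamination contributes its maximal loss
`ε`. Its value is compared with the lower bound `c b + log γ + log √(1+‖θ‖²)` at any slope. -/
theorem IsCMEstimate.maxBias_le (hρ : IsLoss ρ) (hc : 0 ≤ c)
    (hT : IsCMEstimate ρ b c T) (h0 : 0 ≤ ε) (h1 : ε < 1) (hb1 : b < 1 - ε)
    (hσ0 : 0 < σ) (hσ : (1 - ε) * g ρ σ = b - ε) (hγ0 : 0 < γ) (hγ : (1 - ε) * g ρ γ = b)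
    (hmin : ∀ s, γ ≤ s →
      c * ((1 - ε) * g ρ γ) + Real.log γ ≤ c * ((1 - ε) * g ρ s) + Real.log s) :
    maxBias T ε ≤ ENNReal.ofReal √((σ / γ) ^ 2 - 1) := by
  have h1ε : 0 < 1 - ε := sub_pos.2 h1
  have hγ1 : g ρ γ < 1 := by
    by_contra! hge
    have := mul_le_mul_of_nonneg_left hge h1ε.le
    linarith
  refine iSup₂_le fun Hs hHs => ?_
  have hprob : IsProbabilityMeasure (contaminated p ε Hs) :=
    isProbabilityMeasure_contaminated h0 h1.le
  have hLσ : meanLoss ρ (contaminated p ε Hs) 0 0 σ ≤ b := by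
    rw [hρ.meanLoss_contaminated h0 h1.le, hρ.meanLoss_gaussianModel_zero]
    have h2 : meanLoss ρ Hs 0 0 σ ≤ 1 := hρ.integral_le_one Hs (measurable_residual 0 0 σ)
    have h3 := mul_le_mul_of_nonneg_left h2 h0
    simp only [norm_zero, ne_eq, OfNat.ofNat_ne_zero, not_false_eq_true, zero_pow, add_zero,
      Real.sqrt_one, div_one, hσ]
    linarith
  have hne := hρ.slopeMinimizers_nonempty (Hs := Hs) hc h0 h1 hγ0 hγ hγ1 ⟨σ, hσ0, hLσ⟩
  unfold bias
  cases hTH : T (contaminated p ε Hs) with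
  | none => exact absurd ((hT _ hprob).2 hTH) hne.ne_empty
  | some θ =>
    obtain ⟨α, -, hopt⟩ := (hT _ hprob).1 θ hTH
    have hup : objCM ρ b c (contaminated p ε Hs) α θ ≤ ((c * b + Real.log σ : ℝ) : EReal) := by
      refine (hopt 0 0).trans ((objCM_le_of_feasible ⟨hσ0, hLσ⟩).trans (EReal.coe_le_coe_iff.2 ?_))
      gcongr
    have hτ := sqrt_one_add_sq_pos ‖θ‖
    have hlow : ((c * b + Real.log γ + Real.log √(1 + ‖θ‖ ^ 2) : ℝ) : EReal) ≤
        objCM ρ b c (contaminated p ε Hs) α θ := by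
      refine le_objCM fun s hs => EReal.coe_le_coe_iff.2 ?_
      have hs' := hρ.scale_le_of_feasible h0 h1 hγ hγ1 hs
      have e1 := hmin (s / √(1 + ‖θ‖ ^ 2)) ((le_div_iff₀ hτ).2 hs')
      rw [Real.log_div hs.1.ne' hτ.ne', hγ] at e1
      have e2 := mul_le_mul_of_nonneg_left
        (hρ.mul_g_le_meanLoss_contaminated (Hs := Hs) h0 h1.le α θ hs.1) hc
      linarith
    have hlog := EReal.coe_le_coe_iff.1 (hlow.trans hup)
    have hτσ : √(1 + ‖θ‖ ^ 2) ≤ σ / γ := by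
      rw [← Real.log_le_log_iff hτ (div_pos hσ0 hγ0), Real.log_div hσ0.ne' hγ0.ne']
      linarith
    rw [Real.sqrt_le_left (div_pos hσ0 hγ0).le] at hτσ
    simp only [← ofReal_norm]
    exact ENNReal.ofReal_le_ofReal (Real.le_sqrt_of_sq_le (by linarith))

/-- A lower bound for the maximum bias in terms of the optimal values of the objective under
remote contamination and at an exact fit. -/
theorem IsCMEstimate.lt_maxBias (hp : 1 ≤ p) (hρ : IsLoss ρ) (hcont : ContinuousOn (g ρ) (Ioi 0))
    (hb1 : b < 1) (hc : 0 ≤ c) (hT : IsCMEstimate ρ b c T) (h0 : 0 ≤ ε) (h1 : ε < 1)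
    (hσ0 : 0 < σ) (hσ : (1 - ε) * g ρ σ = b - ε) {m s₁ R : ℝ}
    (hm : ∀ s, σ ≤ s → m ≤ c * ((1 - ε) * g ρ s) + Real.log s)
    (hs₁ : 0 < s₁) (hfeas : (1 - ε) * g ρ s₁ ≤ b) (hR : 0 ≤ R)
    (hlt : c * ((1 - ε) * g ρ s₁) + Real.log s₁ + Real.log √(1 + R ^ 2) < c * ε + m) :
    ENNReal.ofReal R < maxBias T ε := by
  have h1ε : 0 < 1 - ε := sub_pos.2 h1
  have hσ1 : g ρ σ < 1 := by
    by_contra! hge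
    have := mul_le_mul_of_nonneg_left hge h1ε.le
    linarith
  obtain ⟨t, htlt, hRt⟩ : ∃ t, c * ((1 - ε) * g ρ s₁) + Real.log s₁ + Real.log √(1 + t ^ 2) <
      c * ε + m ∧ R < t := by
    have hcont : ContinuousAt (fun t : ℝ => c * ((1 - ε) * g ρ s₁) + Real.log s₁ +
        Real.log √(1 + t ^ 2)) R := by
      refine continuousAt_const.add (ContinuousAt.log ?_ (sqrt_one_add_sq_pos R).ne')
      fun_prop
    exact (((hcont.mono_left nhdsWithin_le_nhds).eventually_lt_const hlt).and
      (self_mem_nhdsWithin (s := Ioi R))).exists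
  have hτ := sqrt_one_add_sq_pos t
  set W := c * ((1 - ε) * g ρ s₁) + Real.log s₁ + Real.log √(1 + t ^ 2) with hW
  -- A quarter of the gap: one `κ` is lost on scales slightly below `σ`, which finite spread leaves
  -- feasible, and one because the remote loss is slightly less than `ε`. The resulting `V` still
  -- exceeds `W`.
  set κ := (c * ε + m - W) / 4 with hκ
  have hκ0 : 0 < κ := by rw [hκ]; linarith
  set V := c * ε + m - 2 * κ with hV
  have hWV : W < V := by rw [hV, hκ]; linarith
  obtain ⟨s', hs'm, hs'0, hs'σ⟩ : ∃ s', (∀ s, s' < s → s ≤ σ →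
      m - κ < c * ((1 - ε) * g ρ s) + Real.log s) ∧ 0 < s' ∧ s' < σ := by
    have hca : ContinuousAt (fun s => c * ((1 - ε) * g ρ s) + Real.log s) σ :=
      (continuousAt_const.mul (continuousAt_const.mul
        (hcont.continuousAt (Ioi_mem_nhds hσ0)))).add (Real.continuousAt_log hσ0.ne')
    have hlt' : m - κ < c * ((1 - ε) * g ρ σ) + Real.log σ := by linarith [hm σ le_rfl]
    obtain ⟨l, hl, hsub⟩ := exists_Ioc_subset_of_mem_nhds (hca.eventually_const_lt hlt') ⟨0, hσ0⟩
    refine ⟨max l (σ / 2), fun s hs hsσ => hsub ⟨(le_max_left _ _).trans_lt hs, hsσ⟩, ?_, ?_⟩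
    · exact lt_max_of_lt_right (half_pos hσ0)
    · exact max_lt hl (half_lt_self hσ0)
  have hgap : b < (1 - ε) * g ρ s' + ε * 1 := by
    have := mul_lt_mul_of_pos_left (hρ.g_lt_g hs'0 hs'σ hσ1) h1ε
    linarith
  -- For `s ≥ S` the logarithm alone reaches `V`. For `s < S` the remote loss is at least its value
  -- at `S`, so one `k` serves all scales.
  set S := Real.exp V with hS
  have hS0 : 0 < S := Real.exp_pos V
  have hlim := (hρ.tendsto_g_div_atTop hS0).const_mul ε
  have hlim2 := hlim.const_mul c
  obtain ⟨k, hk1, hk2, hk0⟩ : ∃ k, b < (1 - ε) * g ρ s' + ε * g ρ (S / k) ∧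
      c * (ε * 1) - κ < c * (ε * g ρ (S / k)) ∧ 0 < k :=
    (((hlim.const_add ((1 - ε) * g ρ s')).eventually_const_lt hgap).and
      ((hlim2.eventually_const_lt (sub_lt_self _ hκ0)).and (eventually_gt_atTop 0))).exists
  -- The midpoint leaves room on both sides: strictly above `R` for the strict conclusion, strictly
  -- below the norm `t` of the exact fit.
  have hRt' : R < (R + t) / 2 := by linarith
  refine lt_of_lt_of_le ((ENNReal.ofReal_lt_ofReal_iff (hR.trans_lt hRt')).2 hRt') ?_
  have hs₁τ : s₁ * √(1 + t ^ 2) / √(1 + t ^ 2) = s₁ := mul_div_cancel_right₀ _ hτ.ne'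
  refine hT.le_maxBias hp hρ hc h0 h1.le (hR.trans hRt'.le) (t := t) (by linarith) hk0
    (mul_pos hs₁ hτ) (V := V) (by rwa [hs₁τ]) ?_ fun s hs hsfeas => ?_
  · rw [hs₁τ, Real.log_mul hs₁.ne' hτ.ne']
    linarith
  · rcases le_or_gt S s with hSs | hsS
    · have hlog : V ≤ Real.log s := (Real.le_log_iff_exp_le hs).2 hSs
      refine hlog.trans (le_add_of_nonneg_left (mul_nonneg hc ?_))
      exact add_nonneg (mul_nonneg h1ε.le (hρ.g_nonneg _)) (mul_nonneg h0 (hρ.g_nonneg _))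
    · have hgk : ε * g ρ (S / k) ≤ ε * g ρ (s / k) :=
        mul_le_mul_of_nonneg_left (hρ.g_antitoneOn (div_pos hs hk0) (div_pos hS0 hk0)
          (div_le_div_of_nonneg_right hsS.le hk0.le)) h0
      have hs's : s' < s := by
        by_contra! hle
        have := mul_le_mul_of_nonneg_left (hρ.g_antitoneOn hs hs'0 hle) h1ε.le
        linarith
      have hms : m - κ ≤ c * ((1 - ε) * g ρ s) + Real.log s := by
        rcases le_total s σ with h | h
        · exact (hs'm s hs's h).le
        · linarith [hm s h]
      have := mul_le_mul_of_nonneg_left hgk hc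
      rw [mul_add]
      linarith

/-- Where the tuning constant is small, the objective at the model increases with the scale. -/
theorem IsSmoothUnimodal.monotoneOn_objective {σM : ℝ}
    (hφ : IsSmoothUnimodal ρ σM) (hc : 0 ≤ c) (hcK : c * phi ρ σM ≤ 1) (h0 : 0 ≤ ε)
    (h1 : ε ≤ 1) :
    MonotoneOn (fun s => c * ((1 - ε) * g ρ s) + Real.log s) (Ioi 0) := by
  have hdiff : ∀ s : ℝ, 0 < s → HasDerivAt (g ρ) (deriv (g ρ) s) s := fun s hs =>
    ((hφ.contDiffOn.differentiableOn one_ne_zero).differentiableAt (Ioi_mem_nhds hs)).hasDerivAt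
  have hder : ∀ s : ℝ, 0 < s → HasDerivAt (fun s => c * ((1 - ε) * g ρ s) + Real.log s)
      (c * ((1 - ε) * deriv (g ρ) s) + s⁻¹) s := fun s hs =>
    (((hdiff s hs).const_mul (1 - ε)).const_mul c).add (Real.hasDerivAt_log hs.ne')
  refine monotoneOn_of_deriv_nonneg (convex_Ioi 0)
    (fun s hs => (hder s hs).continuousAt.continuousWithinAt)
    (fun s hs => (hder s (interior_subset hs)).differentiableAt.differentiableWithinAt)
    fun s hs => ?_
  have hs0 : 0 < s := interior_subset hs
  rw [(hder s hs0).deriv]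
  have hφs : phi ρ s ≤ phi ρ σM := by
    rcases le_total s σM with h | h
    · exact hφ.monotoneOn ⟨hs0, h⟩ ⟨hφ.pos, le_rfl⟩ h
    · exact hφ.antitoneOn (mem_Ici.2 le_rfl) h h
  have hcφ : c * phi ρ s ≤ 1 := (mul_le_mul_of_nonneg_left hφs hc).trans hcK
  have hεφ : (1 - ε) * (c * phi ρ s) ≤ 1 :=
    (mul_le_mul_of_nonneg_left hcφ (sub_nonneg.2 h1)).trans (by linarith)
  -- The logarithmic derivative `s h'(s)` is `1 - (1-ε) c φ(s)`, which is why the threshold on `c`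
  -- is `1/K`.
  have : c * ((1 - ε) * deriv (g ρ) s) + s⁻¹ = s⁻¹ * (1 - (1 - ε) * (c * phi ρ s)) := by
    rw [phi]
    field_simp
    ring
  rw [this]
  exact mul_nonneg (inv_pos.2 hs0).le (sub_nonneg.2 hεφ)

theorem IsLoss.le_of_g_eq (hρ : IsLoss ρ) (h0 : 0 ≤ ε) (h1 : ε < 1) (hb1 : b < 1)
    (hσ : (1 - ε) * g ρ σ = b - ε) (hσ0 : 0 < σ) (hγ : (1 - ε) * g ρ γ = b) : γ ≤ σ := by
  have h1ε : 0 < 1 - ε := sub_pos.2 h1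
  by_contra! hlt
  have hγσ : g ρ γ ≤ g ρ σ := hρ.g_antitoneOn hσ0 (hσ0.trans hlt) hlt.le
  have hmul := mul_le_mul_of_nonneg_left hγσ h1ε.le
  have hγ1 : g ρ γ < 1 := by
    by_contra! hge
    have := mul_le_mul_of_nonneg_left hge h1ε.le
    linarith
  have := mul_lt_mul_of_pos_left (hρ.g_lt_g hσ0 hlt hγ1) h1ε
  linarith

/-- The maximum bias of a CM-estimate with small tuning constant. -/
theorem IsCMEstimate.maxBias_eq (hp : 1 ≤ p) (hρ : IsLoss ρ) {σM : ℝ}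
    (hφ : IsSmoothUnimodal ρ σM) (hc : 0 ≤ c) (hcK : c * phi ρ σM ≤ 1)
    (hT : IsCMEstimate ρ b c T) (h0 : 0 ≤ ε) (h1 : ε < 1) (hb1 : b < 1 - ε)
    (hσ0 : 0 < σ) (hσ : (1 - ε) * g ρ σ = b - ε) (hγ0 : 0 < γ) (hγ : (1 - ε) * g ρ γ = b) :
    maxBias T ε = ENNReal.ofReal √((σ / γ) ^ 2 - 1) := by
  have hmono := hφ.monotoneOn_objective hc hcK h0 h1.le
  refine le_antisymm (hT.maxBias_le hρ hc h0 h1 hb1 hσ0 hσ hγ0 hγ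
    fun s hs => hmono hγ0 (hγ0.trans_le hs) hs) ?_
  refine le_of_forall_lt fun x hx => ?_
  lift x to NNReal using hx.ne_top
  rw [ENNReal.lt_ofReal_iff_toReal_lt ENNReal.coe_ne_top, ENNReal.coe_toReal,
    Real.lt_sqrt x.coe_nonneg] at hx
  rw [← ENNReal.ofReal_coe_nnreal]
  -- By monotonicity the infimum over `[σ, ∞)` is attained at `σ`, where the right side is `c ε + c
  -- (b-ε) + log σ`. The left side is `c b + log γ + log √(1+x²)`, so the terms in `c` cancel.
  refine hT.lt_maxBias hp hρ hφ.contDiffOn.continuousOn (by linarith) hc h0 h1 hσ0 hσ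
    (m := c * ((1 - ε) * g ρ σ) + Real.log σ) (s₁ := γ)
    (fun s hs => hmono hσ0 (hσ0.trans_le hs) hs) hγ0 hγ.le x.coe_nonneg ?_
  have hτ : Real.log √(1 + (x : ℝ) ^ 2) < Real.log (σ / γ) := by
    refine Real.log_lt_log (sqrt_one_add_sq_pos _) ?_
    rw [Real.sqrt_lt' (div_pos hσ0 hγ0)]
    linarith
  rw [Real.log_div hσ0.ne' hγ0.ne'] at hτ
  rw [hσ, hγ]
  linarith

end MaxBias

/-! ### The two claims of the theorem -/

theorem theorem6p1 (p : ℕ) (hp : 1 ≤ p) (ρ : ℝ → ℝ) (hρ : MaxBias.IsLoss ρ)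
    (σM : ℝ) (hφ : MaxBias.IsSmoothUnimodal ρ σM)
    (b : ℝ) (hb0 : 0 < b) (hb1 : b < 1) (c : ℝ) (hc : 0 < c)
    (TS TCM : MeasureTheory.Measure (MaxBias.Obs p) → Option (EuclideanSpace ℝ (Fin p)))
    (hS : MaxBias.IsSEstimate ρ b TS) (hCM : MaxBias.IsCMEstimate ρ b c TCM) :
    (c ≤ 1 / MaxBias.phi ρ σM →
      ∀ ε : ℝ, 0 ≤ ε → ε ≤ 1 → MaxBias.maxBias TCM ε = MaxBias.maxBias TS ε) ∧
    (∀ ε σ γ : ℝ, 0 < ε → ε < 1 →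
      0 < σ → MaxBias.g ρ σ = (b - ε) / (1 - ε) →
      0 < γ → MaxBias.g ρ γ = b / (1 - ε) →
      ε⁻¹ * Real.log (σ / γ) < c →
      MaxBias.maxBias TS ε < MaxBias.maxBias TCM ε) := by
  have hS0 := hS.isCMEstimate
  have hcont : ContinuousOn (MaxBias.g ρ) (Set.Ioi 0) := hφ.contDiffOn.continuousOn
  refine ⟨fun hcK ε h0 h1 => ?_, fun ε σ γ h0 h1 hσ0 hσ hγ0 hγ hlt => ?_⟩
  -- Division by zero gives 0, so `0 < c ≤ 1/K` already excludes `K ≤ 0`.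
  · have hK : 0 < MaxBias.phi ρ σM := one_div_pos.1 (hc.trans_le hcK)
    have hcK' : c * MaxBias.phi ρ σM ≤ 1 := (le_div_iff₀ hK).1 hcK
    have h0K : 0 * MaxBias.phi ρ σM ≤ 1 := by simp
    rcases le_or_gt (1 - ε) b with hbε | hbε
    · rw [hCM.maxBias_eq_top_of_one_sub_le hp hρ hb1 hc.le h0 h1 hbε,
        hS0.maxBias_eq_top_of_one_sub_le hp hρ hb1 le_rfl h0 h1 hbε]
    have h1ε : 0 < 1 - ε := hb0.trans hbε
    -- As `(1-ε) g` is continuous with limit `1-ε` at `0+`, a level below `1-ε` that is never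
    -- attained lies strictly below the whole function. Each missing root thus leads to a breakdown
    -- lemma.
    have hex : ∀ v, v < 1 - ε → (¬ ∃ t, 0 < t ∧ (1 - ε) * MaxBias.g ρ t = v) →
        ∀ s, 0 < s → v < (1 - ε) * MaxBias.g ρ s := by
      intro v hv hne s hs
      by_contra! hle
      obtain ⟨t, ht, hgt⟩ := hρ.exists_g_eq hcont hs ((le_div_iff₀' h1ε).2 hle)
        ((div_lt_one h1ε).2 hv)
      exact hne ⟨t, ht, by rw [hgt, mul_div_cancel₀ _ h1ε.ne']⟩
    by_cases hγ : ∃ γ, 0 < γ ∧ (1 - ε) * MaxBias.g ρ γ = b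
    · obtain ⟨γ, hγ0, hγ⟩ := hγ
      by_cases hσ : ∃ σ, 0 < σ ∧ (1 - ε) * MaxBias.g ρ σ = b - ε
      · obtain ⟨σ, hσ0, hσ⟩ := hσ
        rw [hCM.maxBias_eq hp hρ hφ hc.le hcK' h0 (by linarith) hbε hσ0 hσ hγ0 hγ,
          hS0.maxBias_eq hp hρ hφ le_rfl h0K h0 (by linarith) hbε hσ0 hσ hγ0 hγ]
      · have h := hex _ (by linarith) hσ
        rw [hCM.maxBias_eq_top_of_sub_lt hp hρ hc.le h0 h1 hγ0 hγ h,
          hS0.maxBias_eq_top_of_sub_lt hp hρ le_rfl h0 h1 hγ0 hγ h]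
    · have h := hex _ hbε hγ
      rw [hCM.maxBias_eq_top_of_lt hρ h0 h1 h, hS0.maxBias_eq_top_of_lt hρ h0 h1 h]
  · have h1ε : 0 < 1 - ε := sub_pos.2 h1
    rw [eq_div_iff h1ε.ne', mul_comm] at hσ hγ
    have hγσ : γ ≤ σ := hρ.le_of_g_eq h0.le h1 hb1 hσ hσ0 hγ
    -- If `g(γ)` were 1, then `g(σ)` would be 1 too, and the equation for `σ` would give `b = 1`.
    have hb1ε : b < 1 - ε := by
      have hγ1 : MaxBias.g ρ γ < 1 := by
        refine (hρ.g_le_one γ).lt_of_ne fun h => ?_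
        rw [hρ.g_eq_one_of_g_eq_one hγ0 hσ0 h] at hσ
        linarith
      have := mul_lt_mul_of_pos_left hγ1 h1ε
      linarith
    have hr0 : 0 < σ / γ := div_pos hσ0 hγ0
    have hr1 : 1 ≤ (σ / γ) ^ 2 := one_le_pow₀ ((one_le_div hγ0).2 hγσ)
    refine (hS0.maxBias_le hρ le_rfl h0.le h1 hb1ε hσ0 hσ hγ0 hγ fun s hs => ?_).trans_lt ?_
    · rw [zero_mul, zero_mul]
      gcongr
    have hδ : 0 < c * ε - Real.log (σ / γ) := by
      rw [inv_mul_lt_iff₀ h0] at hlt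
      linarith
    set h : ℝ → ℝ := fun s => c * ((1 - ε) * MaxBias.g ρ s) + Real.log s with hh
    have hbdd : BddBelow (h '' Ici σ) := by
      refine ⟨Real.log σ, ?_⟩
      rintro _ ⟨s, hs, rfl⟩
      exact (Real.log_le_log hσ0 hs).trans (le_add_of_nonneg_left
        (mul_nonneg hc.le (mul_nonneg h1ε.le (hρ.g_nonneg s))))
    -- The excess of `c ε` over `log(σ/γ)` is the tolerance within which `s₁` minimizes `h`. Since
    -- `s₁ ≥ σ`, it satisfies the constraint at the exact fit.
    obtain ⟨_, ⟨s₁, hs₁, rfl⟩, hlt₁⟩ := exists_lt_of_csInf_lt (nonempty_Ici.image h)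
      (lt_add_of_pos_right (sInf (h '' Ici σ)) hδ)
    have hs₁0 : 0 < s₁ := hσ0.trans_le hs₁
    refine hCM.lt_maxBias hp hρ hcont hb1 hc.le h0.le h1 hσ0 hσ (m := sInf (h '' Ici σ)) (s₁ := s₁)
      (fun s hs => csInf_le hbdd ⟨s, hs, rfl⟩) hs₁0 ?_ (Real.sqrt_nonneg _) ?_
    · have := mul_le_mul_of_nonneg_left (hρ.g_antitoneOn hσ0 hs₁0 hs₁) h1ε.le
      linarith
    · rw [Real.sq_sqrt (sub_nonneg.2 hr1), add_sub_cancel, Real.sqrt_sq hr0.le]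
      simp only [hh] at hlt₁
      linarith
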